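/- Let $k\in\{1,2,\ldots\}$. For a finitely supported multi-index $\alpha=(\alpha_1,\alpha_2,\ldots)$ of nonnegative integers put $z^\alpha=\prod_j z_j^{\alpha_j}$ and $(2\mathbb N)^{k\alpha}=\prod_j (2j)^{k\alpha_j}$. Let $$\mathbb K_k=\Big\{z\in\mathbb C^{\mathbb N}:\ \sum_{\alpha}|z^\alpha|^{2}(2\mathbb N)^{k\alpha}<\infty\Big\},\qquad K_k(z,w)=\sum_{\alpha} z^\alpha\overline{w^\alpha}\,(2\mathbb N)^{k\alpha}\quad(z,w\in\mathbb K_k),$$ let $\mathcal H(K_k)$ be the reproducing kernel Hilbert space of functions on $\mathbb K_k$ with kernel $K_k$, and let $\mathbf H_2(\mathbb D)\otimes\mathcal H(K_k)$ be the reproducing kernel Hilbert space of functions on $\mathbb D\times\mathbb K_k$ with kernel $K_k(z,w)/(1-\zeta\bar\nu)$. Let $\mathscr S:\mathbb D\times\mathbb K_k\to\mathbb C$ be a Schur multiplier of $\mathbf H_2(\mathbb D)\otimes\mathcal H(K_k)$, that is, multiplication by $\mathscr S$ maps this space contractively into itself. Then the kernel $$\big(1-\mathscr S(\zeta,z)\overline{\mathscr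 S(\nu,w)}\big)\frac{K_k(z,w)}{1-\zeta\bar\nu}$$ is positive on $\mathbb D\times\mathbb K_k$; let $\mathcal H(\mathscr S)$ be the associated reproducing kernel Hilbert space of functions on $\mathbb D\times\mathbb K_k$. Theorem. The formulas $$(Af)(\zeta,z)=\frac{f(\zeta,z)-f(0,z)}{\zeta},\quad (Bx)(\zeta,z)=\frac{\mathscr S(\zeta,z)-\mathscr S(0,z)}{\zeta}\,x(z),\quad (Cf)(z)=f(0,z),\quad (Dx)(z)=\mathscr S(0,z)x(z),$$ for $f\in\mathcal H(\mathscr S)$ and $x\in\mathcal H(K_k)$ (the quotients at $\zeta=0$ being understood as their limits as $\zeta\to0$, which exist), define bounded operators $A:\mathcal H(\mathscr S)\to\mathcal H(\mathscr S)$, $B:\mathcal H(K_k)\to\mathcal H(\mathscr S)$, $C:\mathcal H(\mathscr S)\to\mathcal H(K_k)$, $D:\mathcal H(K_k)\to\mathcal H(K_k)$. The operator $$V=\begin{pmatrix}A&B\\ C&D\end{pmatrix}:\ \mathcal H(\mathscr S)\oplus\mathcal H(K_k)\to\mathcal H(\mathscr S)\oplus\mathcal H(K_k)$$ is coisometric,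 i.e. $VV^*=I$. For every $\zeta\in\mathbb D$ the operator $I-\zeta A$ is boundedly invertible on $\mathcal H(\mathscr S)$, and $$\mathscr S(\zeta,z)\,x(z)=\Big(\big(D+\zeta C(I-\zeta A)^{-1}B\big)x\Big)(z)\qquad (x\in\mathcal H(K_k),\ z\in\mathbb K_k).$$ -/

import Mathlib

open scoped ComplexConjugate Topology Complex.UnitDisc InnerProductSpace ComplexOrder

noncomputable section

/-! ## Scalar reproducing kernels -/

/-- A scalar kernel `κ(x, y)`, as a matrix of operators on the one-dimensional space `ℂ`. -/
def scalarKernel {X : Type*} (κ : X → X → ℂ) : Matrix X X (ℂ →L[ℂ] ℂ) :=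
  Matrix.of fun x y => κ x y • ContinuousLinearMap.id ℂ ℂ

theorem scalarKernel_posSemidef {X : Type*} {κ : X → X → ℂ}
    (hκ : ∀ x y, κ x y = conj (κ y x))
    (h : ∀ c : X →₀ ℂ, 0 ≤ (c.sum fun x a => c.sum fun y b => conj a * b * κ x y).re) :
    (scalarKernel κ).PosSemidef := by
  have key := (RKHS.posSemidef_tfae (K := scalarKernel κ)).out 0 2
  refine key.mpr ⟨?_, fun vv => ?_⟩
  · ext x y
    have hid : star (ContinuousLinearMap.id ℂ ℂ) = ContinuousLinearMap.id ℂ ℂ := star_one _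
    simp [scalarKernel, Matrix.conjTranspose_apply, star_smul, ← hκ, hid]
  · have := h vv
    refine le_of_le_of_eq this (congrArg Complex.re ?_)
    refine Finset.sum_congr rfl fun x _ => Finset.sum_congr rfl fun y _ => ?_
    simp [scalarKernel, ← hκ]
    ring

theorem scalarKernel_posSemidef_of_feature {X E : Type*} [NormedAddCommGroup E]
    [InnerProductSpace ℂ E] {κ : X → X → ℂ} (Φ : X → E) (hΦ : ∀ x y, κ x y = ⟪Φ x, Φ y⟫_ℂ) :
    (scalarKernel κ).PosSemidef := by
  refine scalarKernel_posSemidef (fun x y => ?_) fun c => ?_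
  · rw [hΦ, hΦ, inner_conj_symm]
  · have : (c.sum fun x a => c.sum fun y b => conj a * b * κ x y)
        = ⟪c.sum fun x a => a • Φ x, c.sum fun x a => a • Φ x⟫_ℂ := by
      simp only [Finsupp.sum, sum_inner]
      simp only [inner_sum, hΦ, inner_smul_left, inner_smul_right]
      refine Finset.sum_congr rfl fun x _ => Finset.sum_congr rfl fun y _ => ?_
      ring
    rw [this]
    exact inner_self_nonneg (𝕜 := ℂ)

theorem scalarKernel_posSemidef_of_sum {X ι : Type*} {κ : X → X → ℂ} (φ : X → ι → ℂ)
    (hs : ∀ x, Summable fun i => ‖φ x i‖ ^ 2) (hφ : ∀ x y, κ x y = ∑' i, φ x i * conj (φ y i)) :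
    (scalarKernel κ).PosSemidef := by
  have hm : ∀ x, Memℓp (fun i => conj (φ x i)) 2 := fun x => by
    rw [memℓp_gen_iff (by norm_num)]
    simpa using hs x
  refine scalarKernel_posSemidef_of_feature
    (fun x => (⟨fun i => conj (φ x i), hm x⟩ : lp (fun _ : ι => ℂ) 2)) fun x y => ?_
  rw [hφ, lp.inner_eq_tsum]
  simp [mul_comm]

/-! ## The spaces `𝓗(K_k)` and `𝐇₂(𝔻) ⊗ 𝓗(K_k)` -/

/-- Multi-indices `α = (α₁, α₂, …)` with finitely many nonzero entries. -/
abbrev MultiIndex : Type := ℕ+ →₀ ℕ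

/-- `z^α = z₁^α₁ z₂^α₂ ⋯`. -/
def monomialAt (z : ℕ+ → ℂ) (α : MultiIndex) : ℂ := α.prod fun j a => z j ^ a

/-- `(2ℕ)^(kα) = ∏ⱼ (2j)^(k αⱼ)`. -/
def wickWeight (k : ℕ) (α : MultiIndex) : ℝ := α.prod fun j a => (2 * (j : ℝ)) ^ (k * a)

/-- The infinite-dimensional neighbourhood `𝕂_k` of the origin of `ℂ^ℕ`. -/
def kondratievDomain (k : ℕ) : Set (ℕ+ → ℂ) :=
  {z | Summable fun α : MultiIndex => ‖monomialAt z α‖ ^ 2 * wickWeight k α}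

/-- `K_k(z, w) = ∑_α z^α (w^*)^α (2ℕ)^(kα)`. -/
def kondratievKernel (k : ℕ) (z w : kondratievDomain k) : ℂ :=
  ∑' α : MultiIndex, monomialAt z α * conj (monomialAt w α) * (wickWeight k α : ℂ)

/-- `K_k(z, w) / (1 - ζ ν^*)` on `𝔻 × 𝕂_k`, the reproducing kernel of `𝐇₂(𝔻) ⊗ 𝓗(K_k)`. -/
def hardyKondratievKernel (k : ℕ) (p q : 𝔻 × kondratievDomain k) : ℂ :=
  kondratievKernel k p.2 q.2 / (1 - (p.1 : ℂ) * conj (q.1 : ℂ))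

theorem wickWeight_nonneg (k : ℕ) (α : MultiIndex) : 0 ≤ wickWeight k α :=
  Finset.prod_nonneg fun j _ => by positivity

def kondratievFeature (k : ℕ) (z : kondratievDomain k) (α : MultiIndex) : ℂ :=
  monomialAt z α * (Real.sqrt (wickWeight k α) : ℂ)

theorem kondratievFeature_summable (k : ℕ) (z : kondratievDomain k) :
    Summable fun α => ‖kondratievFeature k z α‖ ^ 2 := by
  refine z.2.congr fun α => ?_
  simp only [kondratievFeature, norm_mul, mul_pow, Complex.norm_real, Real.norm_eq_abs, sq_abs,
    Real.sq_sqrt (wickWeight_nonneg k α)]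

theorem kondratievFeature_mul (k : ℕ) (z w : kondratievDomain k) (α : MultiIndex) :
    kondratievFeature k z α * conj (kondratievFeature k w α)
      = monomialAt z α * conj (monomialAt w α) * (wickWeight k α : ℂ) := by
  have h : (Real.sqrt (wickWeight k α) : ℂ) * (Real.sqrt (wickWeight k α) : ℂ)
      = (wickWeight k α : ℂ) := by
    rw [← Complex.ofReal_mul, Real.mul_self_sqrt (wickWeight_nonneg k α)]
  simp only [kondratievFeature, map_mul, Complex.conj_ofReal]
  rw [← h]
  ring

instance kondratievKernel_posSemidef (k : ℕ) :
    Fact (scalarKernel (kondratievKernel k)).PosSemidef :=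
  ⟨scalarKernel_posSemidef_of_sum (kondratievFeature k) (kondratievFeature_summable k)
    fun z w => by simp only [kondratievFeature_mul, kondratievKernel]⟩

theorem summable_norm_mul_of_sq {ι : Type*} {f g : ι → ℂ} (hf : Summable fun i => ‖f i‖ ^ 2)
    (hg : Summable fun i => ‖g i‖ ^ 2) : Summable fun i => ‖f i * conj (g i)‖ := by
  refine Summable.of_nonneg_of_le (fun i => norm_nonneg _) (fun i => ?_) (hf.add hg)
  rw [norm_mul, RCLike.norm_conj]
  nlinarith [sq_nonneg (‖f i‖ - ‖g i‖), sq_nonneg (‖f i‖), sq_nonneg (‖g i‖)]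

instance hardyKondratievKernel_posSemidef (k : ℕ) :
    Fact (scalarKernel (hardyKondratievKernel k)).PosSemidef := by
  have hgeo : ∀ ζ : 𝔻, Summable fun n : ℕ => ‖(ζ : ℂ) ^ n‖ ^ 2 := fun ζ => by
    have : Summable fun n : ℕ => (‖(ζ : ℂ)‖ ^ 2) ^ n :=
      summable_geometric_of_lt_one (by positivity)
        (by have := ζ.norm_lt_one; have := norm_nonneg (ζ : ℂ); nlinarith)
    refine this.congr fun n => ?_
    rw [norm_pow, ← pow_mul, ← pow_mul, mul_comm]
  refine ⟨scalarKernel_posSemidef_of_sum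
    (fun p (i : ℕ × MultiIndex) => (p.1 : ℂ) ^ i.1 * kondratievFeature k p.2 i.2)
    (fun p => ?_) fun p q => ?_⟩
  · simp only [norm_mul, mul_pow]
    exact (hgeo p.1).mul_of_nonneg (kondratievFeature_summable k p.2)
      (fun _ => by positivity) (fun _ => by positivity)
  · have h1 := tsum_mul_tsum_of_summable_norm (summable_norm_mul_of_sq (hgeo p.1) (hgeo q.1))
      (summable_norm_mul_of_sq (kondratievFeature_summable k p.2)
        (kondratievFeature_summable k q.2))
    have h2 : ∑' n : ℕ, (p.1 : ℂ) ^ n * conj ((q.1 : ℂ) ^ n)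
        = (1 - (p.1 : ℂ) * conj (q.1 : ℂ))⁻¹ := by
      rw [← tsum_geometric_of_norm_lt_one]
      · simp only [map_pow, mul_pow]
      · rw [norm_mul, RCLike.norm_conj]
        have := p.1.norm_lt_one
        have := q.1.norm_lt_one
        have := norm_nonneg (p.1 : ℂ)
        have := norm_nonneg (q.1 : ℂ)
        nlinarith
    have h3 : ∑' α, kondratievFeature k p.2 α * conj (kondratievFeature k q.2 α)
        = kondratievKernel k p.2 q.2 := by simp only [kondratievFeature_mul, kondratievKernel]
    rw [h2, h3] at h1
    rw [hardyKondratievKernel, div_eq_inv_mul, h1]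
    refine tsum_congr fun i => ?_
    rw [map_mul]
    ring

/-- `𝓗(K_k)`, the Hilbert space of functions on `𝕂_k` with reproducing kernel `K_k`. -/
abbrev KondratievSpace (k : ℕ) : Type := RKHS.OfKernel (scalarKernel (kondratievKernel k))

/-- `𝐇₂(𝔻) ⊗ 𝓗(K_k)`, the Hilbert space of functions on `𝔻 × 𝕂_k` with reproducing kernel
`K_k(z, w) / (1 - ζ ν^*)`. -/
abbrev HardyKondratievSpace (k : ℕ) : Type :=
  RKHS.OfKernel (scalarKernel (hardyKondratievKernel k))

/-! ## Schur multipliers and their de Branges–Rovnyak spaces -/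

/-- `S` is a Schur multiplier of `𝐇₂(𝔻) ⊗ 𝓗(K_k)`: multiplication by `S` is a contraction of this
space into itself. -/
class IsSchurMultiplier (k : ℕ) (S : 𝔻 × kondratievDomain k → ℂ) : Prop where
  exists_mul : ∀ f : HardyKondratievSpace k,
    ∃ g : HardyKondratievSpace k, (∀ p, g p = S p * f p) ∧ ‖g‖ ≤ ‖f‖

/-- `(1 - S(ζ, z) S(ν, w)^*) K_k(z, w) / (1 - ζ ν^*)`. -/
def deBrangesRovnyakKernel (k : ℕ) (S : 𝔻 × kondratievDomain k → ℂ)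
    (p q : 𝔻 × kondratievDomain k) : ℂ :=
  (1 - S p * conj (S q)) * hardyKondratievKernel k p q

instance deBrangesRovnyakKernel_posSemidef (k : ℕ) (S : 𝔻 × kondratievDomain k → ℂ)
    [hS : IsSchurMultiplier k S] :
    Fact (scalarKernel (deBrangesRovnyakKernel k S)).PosSemidef := by
  set k₁ : 𝔻 × kondratievDomain k → HardyKondratievSpace k :=
    fun p => RKHS.kerFun (HardyKondratievSpace k) p 1 with hk₁
  have hker : ∀ p q, ⟪k₁ p, k₁ q⟫_ℂ = hardyKondratievKernel k p q := fun p q => by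
    simp only [hk₁]
    rw [RKHS.kerFun_inner, RKHS.kerFun_apply, RKHS.OfKernel.kernel_ofKernel]
    simp [scalarKernel]
  have hrep : ∀ p (f : HardyKondratievSpace k), ⟪k₁ p, f⟫_ℂ = f p := fun p f => by
    simp only [hk₁]
    rw [RKHS.kerFun_inner]
    simp
  refine ⟨scalarKernel_posSemidef (fun p q => ?_) fun c => ?_⟩
  · simp only [deBrangesRovnyakKernel, ← hker, map_mul, map_sub, map_one, inner_conj_symm,
      Complex.conj_conj]
    ring
  · set u : HardyKondratievSpace k := c.sum fun p a => a • k₁ p with hu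
    set v : HardyKondratievSpace k := c.sum fun p a => (a * conj (S p)) • k₁ p with hv
    have h1 : (c.sum fun p a => c.sum fun q b => conj a * b * deBrangesRovnyakKernel k S p q)
        = ⟪u, u⟫_ℂ - ⟪v, v⟫_ℂ := by
      simp only [hu, hv, Finsupp.sum, sum_inner]
      simp only [inner_sum, inner_smul_left, inner_smul_right, hker,
        deBrangesRovnyakKernel, ← Finset.sum_sub_distrib, map_mul, Complex.conj_conj]
      refine Finset.sum_congr rfl fun x _ => Finset.sum_congr rfl fun y _ => ?_
      ring
    obtain ⟨g, hg, hle⟩ := hS.exists_mul v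
    have h2 : ⟪u, g⟫_ℂ = ⟪v, v⟫_ℂ := by
      rw [hu]
      nth_rewrite 1 [hv]
      simp only [Finsupp.sum, sum_inner, inner_smul_left, hrep, hg, map_mul, Complex.conj_conj]
      refine Finset.sum_congr rfl fun x _ => ?_
      ring
    have h3 : ‖v‖ ≤ ‖u‖ := by
      have h4 := norm_inner_le_norm (𝕜 := ℂ) u g
      rw [h2, inner_self_eq_norm_sq_to_K] at h4
      have h5 : ‖v‖ ^ 2 ≤ ‖u‖ * ‖v‖ := by
        refine le_trans (le_of_eq ?_) (h4.trans (mul_le_mul_of_nonneg_left hle (norm_nonneg u)))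
        simp
      by_contra! h6
      nlinarith [norm_nonneg u]
    rw [h1, inner_self_eq_norm_sq_to_K, inner_self_eq_norm_sq_to_K]
    have h7 : ((‖u‖ : ℂ) ^ 2 - (‖v‖ : ℂ) ^ 2).re = ‖u‖ ^ 2 - ‖v‖ ^ 2 := by
      rw [← Complex.ofReal_pow, ← Complex.ofReal_pow, ← Complex.ofReal_sub, Complex.ofReal_re]
    refine le_of_le_of_eq ?_ h7.symm
    nlinarith [norm_nonneg v]

/-- `𝓗(S)`, the Hilbert space of functions on `𝔻 × 𝕂_k` with reproducing kernel
`(1 - S(ζ, z) S(ν, w)^*) K_k(z, w) / (1 - ζ ν^*)`. -/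
abbrev DeBrangesRovnyakSpace (k : ℕ) (S : 𝔻 × kondratievDomain k → ℂ)
    [IsSchurMultiplier k S] : Type :=
  RKHS.OfKernel (scalarKernel (deBrangesRovnyakKernel k S))

/-! ## Realizations -/

/-- `G(ζ, z) = (F(ζ, z) - F(0, z)) / ζ`, the value at `ζ = 0` being the limit of the quotient
as `ζ → 0`. -/
def IsBackwardShift {Z : Type*} (F G : 𝔻 × Z → ℂ) : Prop :=
  ∀ z : Z,
    (∀ ζ : 𝔻, ζ ≠ 0 → G (ζ, z) = (F (ζ, z) - F (0, z)) / (ζ : ℂ)) ∧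
    Filter.Tendsto (fun ζ : 𝔻 => (F (ζ, z) - F (0, z)) / (ζ : ℂ)) (𝓝[≠] 0) (𝓝 (G (0, z)))

/-- The operator matrix `(A B; C D)` between Hilbert direct sums `H ⊕ U → H ⊕ Y`. -/
def blockOperator {H U Y : Type*} [NormedAddCommGroup H] [InnerProductSpace ℂ H]
    [NormedAddCommGroup U] [InnerProductSpace ℂ U] [NormedAddCommGroup Y] [InnerProductSpace ℂ Y]
    (A : H →L[ℂ] H) (B : U →L[ℂ] H) (C : H →L[ℂ] Y) (D : U →L[ℂ] Y) :
    WithLp 2 (H × U) →L[ℂ] WithLp 2 (H × Y) :=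
  (WithLp.prodContinuousLinearEquiv 2 ℂ H Y).symm.toContinuousLinearMap ∘L
    ((A.coprod B).prod (C.coprod D)) ∘L
    (WithLp.prodContinuousLinearEquiv 2 ℂ H U).toContinuousLinearMap

/-- A bounded operator `V` between Hilbert spaces is coisometric if `V V^* = I`. -/
def IsCoisometric {E F : Type*} [NormedAddCommGroup E] [InnerProductSpace ℂ E] [CompleteSpace E]
    [NormedAddCommGroup F] [InnerProductSpace ℂ F] [CompleteSpace F] (V : E →L[ℂ] F) : Prop :=
  V ∘L ContinuousLinearMap.adjoint V = ContinuousLinearMap.id ℂ F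

end

open scoped ComplexConjugate Topology Complex.UnitDisc InnerProductSpace ComplexOrder

noncomputable section

/-! ## Isometric extension and complex reproducing kernel spaces -/

/-! Write K for `kondratievKernel`, K_S for `deBrangesRovnyakKernel`, and p = (ζ, z), q = (ν, w).
Multiplying out the denominator gives ζ ν̄ K_S(p, q) + K(z, w) = K_S(p, q) + S(p) S(q)^* K(z, w),
which says that the vectors (ζ̄ K_S(·, p), K(·, z)) and (K_S(·, p), S(p)^* K(·, z)) have the same
Gram matrix. The first family is total, so one isometry U carries it to the second ("lurking
isometry"). Put V = U^*; then V V^* = U^* U = I.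

Pairing V(f, x) with the first family gives a single pointwise identity ζ (Af + Bx)(ζ, z) + (Cf +
Dx)(z) = f(ζ, z) + S(ζ, z) x(z), from which all four formulas and the realization follow. At ζ = 0
the quotients need continuity in ζ, which is inherited from the kernels. -/

/-- Two families with the same Gram matrix, the first of them total, are intertwined by a linear
map preserving norms. -/
theorem exists_isometry_of_inner_eq {ι E F : Type*} [NormedAddCommGroup E]
    [InnerProductSpace ℂ E] [CompleteSpace E] [NormedAddCommGroup F] [InnerProductSpace ℂ F]
    [CompleteSpace F] (g : ι → E) (h : ι → F) (hgh : ∀ i j, ⟪g i, g j⟫_ℂ = ⟪h i, h j⟫_ℂ)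
    (htotal : ∀ u : E, (∀ i, ⟪g i, u⟫_ℂ = 0) → u = 0) :
    ∃ U : E →L[ℂ] F, (∀ i, U (g i) = h i) ∧ ∀ u, ‖U u‖ = ‖u‖ := by
  set e := Finsupp.linearCombination ℂ g with he
  set f := Finsupp.linearCombination ℂ h with hf
  have hinner : ∀ c, ⟪e c, e c⟫_ℂ = ⟪f c, f c⟫_ℂ := fun c => by
    simp only [he, hf, Finsupp.linearCombination_apply, Finsupp.sum, sum_inner]
    simp only [inner_sum, inner_smul_left, inner_smul_right, hgh]
  have hnorm : ∀ c, ‖f c‖ = ‖e c‖ := fun c => by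
    rw [@norm_eq_sqrt_re_inner ℂ, @norm_eq_sqrt_re_inner ℂ, hinner]
  have hdense : DenseRange e := by
    have hspan : (Submodule.span ℂ (Set.range g)).topologicalClosure = ⊤ := by
      rw [Submodule.topologicalClosure_eq_top_iff, Submodule.eq_bot_iff]
      exact fun u hu => htotal u fun i =>
        Submodule.inner_right_of_mem_orthogonal (Submodule.subset_span (Set.mem_range_self i)) hu
    have := Submodule.dense_iff_topologicalClosure_eq_top.mpr hspan
    rwa [← Finsupp.range_linearCombination] at this
  have hbound : ∀ c, ‖f c‖ ≤ 1 * ‖e c‖ := fun c => by rw [hnorm, one_mul]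
  have heq := LinearMap.extendOfNorm_eq hdense ⟨1, hbound⟩
  refine ⟨f.extendOfNorm e, fun i => ?_, fun u => ?_⟩
  · simpa [he, hf] using heq (Finsupp.single i 1)
  · refine hdense.induction (P := fun u => ‖f.extendOfNorm e u‖ = ‖u‖) ?_
      (isClosed_eq (by fun_prop) (by fun_prop)) u
    rintro _ ⟨c, rfl⟩
    rw [heq, hnorm]

section ScalarKernel

variable {X : Type*} (κ : X → X → ℂ) [Fact (scalarKernel κ).PosSemidef]

/-- The kernel function `κ(·, q)` of the Hilbert space with scalar reproducing kernel `κ`. -/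
def kernelVector (q : X) : RKHS.OfKernel (scalarKernel κ) :=
  RKHS.kerFun (RKHS.OfKernel (scalarKernel κ)) q 1

theorem kernelVector_apply (p q : X) : kernelVector κ q p = κ p q := by
  rw [kernelVector, RKHS.kerFun_apply, RKHS.OfKernel.kernel_ofKernel]
  simp [scalarKernel]

variable {κ}

theorem kernelVector_inner (q : X) (f : RKHS.OfKernel (scalarKernel κ)) :
    ⟪kernelVector κ q, f⟫_ℂ = f q := by
  rw [kernelVector, RKHS.kerFun_inner]
  simp

theorem kernelVector_inner_kernelVector (p q : X) :
    ⟪kernelVector κ p, kernelVector κ q⟫_ℂ = κ p q := by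
  rw [kernelVector_inner, kernelVector_apply]

/-- The squared distance between two kernel vectors is a combination of four kernel values, so they
vary norm-continuously, and evaluation is the inner product with them. -/
theorem continuous_apply_of_continuous_kernel {T : Type*} [TopologicalSpace T] {γ : T → X}
    (hκ : Continuous fun s : T × T => κ (γ s.1) (γ s.2))
    (f : RKHS.OfKernel (scalarKernel κ)) : Continuous fun t => f (γ t) := by
  have hsq : ∀ s t, ‖kernelVector κ (γ t) - kernelVector κ (γ s)‖ ^ 2
      = (κ (γ t) (γ t) - κ (γ t) (γ s) - (κ (γ s) (γ t) - κ (γ s) (γ s))).re := fun s t => by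
    rw [@norm_sq_eq_re_inner ℂ, inner_sub_left, inner_sub_right, inner_sub_right]
    simp only [kernelVector_inner_kernelVector]
    rfl
  have hk : Continuous fun t => kernelVector κ (γ t) := by
    refine continuous_iff_continuousAt.mpr fun s => ?_
    rw [ContinuousAt, tendsto_iff_norm_sub_tendsto_zero]
    have h1 : Continuous fun t => κ (γ t) (γ t) :=
      hκ.comp (continuous_id.prodMk continuous_id)
    have h2 : Continuous fun t => κ (γ t) (γ s) :=
      hκ.comp (continuous_id.prodMk continuous_const)
    have h3 : Continuous fun t => κ (γ s) (γ t) :=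
      hκ.comp (continuous_const.prodMk continuous_id)
    have h4 : Continuous fun t => ‖kernelVector κ (γ t) - kernelVector κ (γ s)‖ ^ 2 := by
      simp only [hsq]
      exact Complex.continuous_re.comp ((h1.sub h2).sub (h3.sub continuous_const))
    have h5 := (Real.continuous_sqrt.comp h4).tendsto s
    simpa [Function.comp_def, Real.sqrt_sq] using h5
  simp only [← kernelVector_inner]
  exact hk.inner continuous_const

end ScalarKernel

instance unitDisc_nhdsWithin_compl_zero_neBot : (𝓝[≠] (0 : 𝔻)).NeBot := by
  rw [← mem_closure_iff_nhdsWithin_neBot]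
  refine mem_closure_of_tendsto (b := Filter.atTop)
    -- The points 1/(n + 2): the extra 1 keeps n = 0 inside the open disc.
    (f := fun n : ℕ => Complex.UnitDisc.mk (1 / ((n : ℂ) + 1 + 1)) ?_) ?_ ?_
  · have h : ((n : ℂ) + 1 + 1) = ((n + 1 + 1 : ℝ) : ℂ) := by push_cast; ring
    rw [h, norm_div, norm_one, Complex.norm_real, Real.norm_eq_abs, abs_of_pos (by positivity),
      div_lt_one (by positivity)]
    have : (0 : ℝ) ≤ n := n.cast_nonneg
    linarith
  · rw [Complex.UnitDisc.isEmbedding_coe.tendsto_nhds_iff]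
    have h := (tendsto_one_div_add_atTop_nhds_zero_nat (𝕜 := ℂ)).comp (Filter.tendsto_add_atTop_nat 1)
    simpa [Function.comp_def] using h
  · refine Filter.Eventually.of_forall fun n => ?_
    have : ((n : ℂ) + 1 + 1) ≠ 0 := by exact_mod_cast (n + 1).succ_ne_zero
    simpa using this

/-! ## The constant function one -/

theorem monomialAt_zero (α : MultiIndex) : monomialAt 0 α = if α = 0 then 1 else 0 := by
  split_ifs with h
  · simp [monomialAt, h]
  · obtain ⟨j, hj⟩ := Finsupp.support_nonempty_iff.mpr h
    exact Finset.prod_eq_zero hj (by simpa using hj)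

/-- The origin of `𝕂_k`. -/
def kondratievOrigin (k : ℕ) : kondratievDomain k :=
  ⟨0, summable_of_ne_finset_zero (s := {0}) fun α hα => by
    simp [monomialAt_zero, Finset.notMem_singleton.mp hα]⟩

/-- Only α = 0 survives at the origin. Hence the constant 1 belongs to 𝓗(K_k), so multipliers can be
recovered from their action on it. -/
theorem kondratievKernel_origin (k : ℕ) (z : kondratievDomain k) :
    kondratievKernel k z (kondratievOrigin k) = 1 := by
  rw [kondratievKernel, tsum_eq_single 0]
  · simp [kondratievOrigin, monomialAt, wickWeight]
  · intro α hα
    simp [kondratievOrigin, monomialAt_zero, hα]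

/-! ## Continuity in the disc variable -/

theorem one_sub_mul_conj_ne_zero (ζ ν : 𝔻) : 1 - (ζ : ℂ) * conj (ν : ℂ) ≠ 0 := by
  refine sub_ne_zero.mpr fun h => ?_
  have h1 : ‖(ζ : ℂ)‖ * ‖(ν : ℂ)‖ = 1 := by
    rw [← RCLike.norm_conj (ν : ℂ), ← norm_mul, ← h, norm_one]
  nlinarith [ζ.norm_lt_one, ν.norm_lt_one, norm_nonneg (ζ : ℂ), norm_nonneg (ν : ℂ)]

theorem continuous_hardyKondratievKernel (k : ℕ) (z w : kondratievDomain k) :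
    Continuous fun s : 𝔻 × 𝔻 => hardyKondratievKernel k (s.1, z) (s.2, w) := by
  have hc := Complex.UnitDisc.continuous_coe
  have h : Continuous fun s : 𝔻 × 𝔻 => 1 - (s.1 : ℂ) * conj (s.2 : ℂ) :=
    continuous_const.sub ((hc.comp continuous_fst).mul
      (Complex.continuous_conj.comp (hc.comp continuous_snd)))
  exact Continuous.div (f := fun _ => kondratievKernel k z w) continuous_const h
    fun s => one_sub_mul_conj_ne_zero s.1 s.2

/-- The kernel function at (0, origin) is the constant 1, so S = S · 1 is itself an element of the
Hardy–Kondratiev space. -/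
theorem IsSchurMultiplier.continuous_disc {k : ℕ} {S : 𝔻 × kondratievDomain k → ℂ}
    (hS : IsSchurMultiplier k S) (z : kondratievDomain k) : Continuous fun ζ : 𝔻 => S (ζ, z) := by
  obtain ⟨g, hg, -⟩ :=
    hS.exists_mul (kernelVector (hardyKondratievKernel k) (0, kondratievOrigin k))
  have h : ∀ p, S p = g p := fun p => by
    rw [hg, kernelVector_apply, hardyKondratievKernel, kondratievKernel_origin]
    simp
  simp only [h]
  exact continuous_apply_of_continuous_kernel (continuous_hardyKondratievKernel k z z) g

theorem continuous_deBrangesRovnyak_disc {k : ℕ} {S : 𝔻 × kondratievDomain k → ℂ}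
    [hS : IsSchurMultiplier k S] (f : DeBrangesRovnyakSpace k S) (z : kondratievDomain k) :
    Continuous fun ζ : 𝔻 => f (ζ, z) := by
  refine continuous_apply_of_continuous_kernel (γ := fun ζ : 𝔻 => (ζ, z)) ?_ f
  have hc := hS.continuous_disc z
  exact (continuous_const.sub ((hc.comp continuous_fst).mul
    (Complex.continuous_conj.comp (hc.comp continuous_snd)))).mul
    (continuous_hardyKondratievKernel k z z)

theorem isBackwardShift_of_mul_add {Z : Type*} {F G : 𝔻 × Z → ℂ}
    (h : ∀ (ζ : 𝔻) z, (ζ : ℂ) * G (ζ, z) + F (0, z) = F (ζ, z))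
    (hG : ∀ z, Continuous fun ζ : 𝔻 => G (ζ, z)) : IsBackwardShift F G := fun z => by
  have hq : ∀ ζ : 𝔻, ζ ≠ 0 → G (ζ, z) = (F (ζ, z) - F (0, z)) / (ζ : ℂ) := fun ζ hζ => by
    rw [eq_div_iff (by simpa using hζ), ← h ζ z]
    ring
  exact ⟨hq, (((hG z).tendsto 0).mono_left nhdsWithin_le_nhds).congr'
    (Filter.mem_of_superset self_mem_nhdsWithin hq)⟩

/-! ## The coisometric colligation -/

/-- This U is the adjoint of the colligation sought. -/
theorem exists_deBrangesRovnyak_isometry (k : ℕ) (S : 𝔻 × kondratievDomain k → ℂ)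
    [IsSchurMultiplier k S] :
    ∃ U : WithLp 2 (DeBrangesRovnyakSpace k S × KondratievSpace k) →L[ℂ]
        WithLp 2 (DeBrangesRovnyakSpace k S × KondratievSpace k),
      (∀ p : 𝔻 × kondratievDomain k,
        U (WithLp.toLp 2 (conj (p.1 : ℂ) • kernelVector (deBrangesRovnyakKernel k S) p,
            kernelVector (kondratievKernel k) p.2))
          = WithLp.toLp 2 (kernelVector (deBrangesRovnyakKernel k S) p,
            conj (S p) • kernelVector (kondratievKernel k) p.2)) ∧
      ∀ u, ‖U u‖ = ‖u‖ := by
  refine exists_isometry_of_inner_eq _ _ (fun p q => ?_) fun u hu => ?_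
  · simp only [WithLp.prod_inner_apply, inner_smul_left, inner_smul_right,
      kernelVector_inner_kernelVector, Complex.conj_conj, deBrangesRovnyakKernel]
    have h : (1 - (p.1 : ℂ) * conj (q.1 : ℂ)) * hardyKondratievKernel k p q
        = kondratievKernel k p.2 q.2 := mul_div_cancel₀ _ (one_sub_mul_conj_ne_zero p.1 q.1)
    linear_combination -(1 - S p * conj (S q)) * h
  -- Orthogonality to the family reads ζ u₁(ζ, z) + u₂(z) = 0: ζ = 0 kills u₂, then u₁ vanishes for
  -- ζ ≠ 0, and at 0 by continuity.
  · simp only [WithLp.prod_inner_apply, inner_smul_left, kernelVector_inner,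
      Complex.conj_conj] at hu
    have h2 : u.snd = 0 := RKHS.ext fun z => by simpa using hu (0, z)
    have h1 : ∀ (ζ : 𝔻) z, ζ ≠ 0 → u.fst (ζ, z) = 0 := fun ζ z hζ => by
      have := hu (ζ, z)
      simpa [h2, hζ] using this
    have h3 : u.fst = 0 := RKHS.ext fun p => by
      obtain ⟨ζ, z⟩ := p
      rw [RKHS.coe_zero, Pi.zero_apply]
      by_cases hζ : ζ = 0
      · subst hζ
        refine tendsto_nhds_unique
          (((continuous_deBrangesRovnyak_disc u.fst z).tendsto 0).mono_left nhdsWithin_le_nhds)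
          ((tendsto_const_nhds (x := (0 : ℂ)) (f := 𝓝[≠] (0 : 𝔻))).congr' ?_)
        exact Filter.mem_of_superset self_mem_nhdsWithin fun ζ hζ => (h1 ζ z hζ).symm
      · exact h1 ζ z hζ
    exact WithLp.ofLp_injective 2 (Prod.ext h3 h2)

theorem exists_blockOperator_eq {H U Y : Type*} [NormedAddCommGroup H] [InnerProductSpace ℂ H]
    [NormedAddCommGroup U] [InnerProductSpace ℂ U] [NormedAddCommGroup Y] [InnerProductSpace ℂ Y]
    (V : WithLp 2 (H × U) →L[ℂ] WithLp 2 (H × Y)) :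
    ∃ (A : H →L[ℂ] H) (B : U →L[ℂ] H) (C : H →L[ℂ] Y) (D : U →L[ℂ] Y),
      blockOperator A B C D = V := by
  set W := (WithLp.prodContinuousLinearEquiv 2 ℂ H Y).toContinuousLinearMap ∘L V ∘L
    (WithLp.prodContinuousLinearEquiv 2 ℂ H U).symm.toContinuousLinearMap with hW
  refine ⟨.fst ℂ H Y ∘L W ∘L .inl ℂ H U, .fst ℂ H Y ∘L W ∘L .inr ℂ H U,
    .snd ℂ H Y ∘L W ∘L .inl ℂ H U, .snd ℂ H Y ∘L W ∘L .inr ℂ H U, ?_⟩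
  ext u : 1
  have h : W (u.fst, 0) + W (0, u.snd) = (V u).ofLp := by
    rw [← map_add, Prod.mk_add_mk, add_zero, zero_add]
    rfl
  have h' : blockOperator (.fst ℂ H Y ∘L W ∘L .inl ℂ H U) (.fst ℂ H Y ∘L W ∘L .inr ℂ H U)
    (.snd ℂ H Y ∘L W ∘L .inl ℂ H U) (.snd ℂ H Y ∘L W ∘L .inr ℂ H U) u
      = WithLp.toLp 2 (W (u.fst, 0) + W (0, u.snd)) := rfl
  rw [h', h]

theorem mainTheorem8 (k : ℕ) (hk : 1 ≤ k) (S : 𝔻 × kondratievDomain k → ℂ)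
    [IsSchurMultiplier k S] :
    ∃ (A : DeBrangesRovnyakSpace k S →L[ℂ] DeBrangesRovnyakSpace k S)
      (B : KondratievSpace k →L[ℂ] DeBrangesRovnyakSpace k S)
      (C : DeBrangesRovnyakSpace k S →L[ℂ] KondratievSpace k)
      (D : KondratievSpace k →L[ℂ] KondratievSpace k),
      (∀ f : DeBrangesRovnyakSpace k S, IsBackwardShift f (A f)) ∧
      (∃ R : 𝔻 × kondratievDomain k → ℂ, IsBackwardShift S R ∧
        ∀ (x : KondratievSpace k) (ζ : 𝔻) (z : kondratievDomain k),
          B x (ζ, z) = R (ζ, z) * x z) ∧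
      (∀ (f : DeBrangesRovnyakSpace k S) (z : kondratievDomain k), C f z = f (0, z)) ∧
      (∀ (x : KondratievSpace k) (z : kondratievDomain k), D x z = S (0, z) * x z) ∧
      IsCoisometric (blockOperator A B C D) ∧
      ∀ ζ : 𝔻, IsUnit (1 - (ζ : ℂ) • A) ∧
        ∀ (x : KondratievSpace k) (z : kondratievDomain k),
          S (ζ, z) * x z
            = (D + (ζ : ℂ) • (C ∘L Ring.inverse (1 - (ζ : ℂ) • A) ∘L B)) x z := by
  obtain ⟨U, hU, hnorm⟩ := exists_deBrangesRovnyak_isometry k S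
  obtain ⟨A, B, C, D, hV⟩ := exists_blockOperator_eq (ContinuousLinearMap.adjoint U)
  have happly : ∀ f x, ContinuousLinearMap.adjoint U (WithLp.toLp 2 (f, x))
      = WithLp.toLp 2 (A f + B x, C f + D x) := fun f x => by
    rw [← hV]
    rfl
  have key : ∀ f x (ζ : 𝔻) (z : kondratievDomain k),
      (ζ : ℂ) * (A f (ζ, z) + B x (ζ, z)) + (C f z + D x z) = f (ζ, z) + S (ζ, z) * x z :=
    fun f x ζ z => by
      have h := ContinuousLinearMap.adjoint_inner_right U
        (WithLp.toLp 2 (conj (ζ : ℂ) • kernelVector (deBrangesRovnyakKernel k S) (ζ, z),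
            kernelVector (kondratievKernel k) z)) (WithLp.toLp 2 (f, x))
      rw [happly, hU (ζ, z)] at h
      simpa [WithLp.prod_inner_apply, inner_smul_left, kernelVector_inner, inner_add_right, mul_add]
        using h
  -- Specializations of `key`: ζ = 0 isolates C and D; then x = 0 gives A and f = 0 gives B.
  have hC : ∀ f z, C f z = f (0, z) := fun f z => by simpa using key f 0 0 z
  have hD : ∀ x z, D x z = S (0, z) * x z := fun x z => by simpa using key 0 x 0 z
  have hA : ∀ f (ζ : 𝔻) z, (ζ : ℂ) * A f (ζ, z) + f (0, z) = f (ζ, z) := fun f ζ z => by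
    simpa [hC] using key f 0 ζ z
  have hB : ∀ x (ζ : 𝔻) z, (ζ : ℂ) * B x (ζ, z) + S (0, z) * x z = S (ζ, z) * x z :=
    fun x ζ z => by simpa [hD] using key 0 x ζ z
  have hcont := fun f : DeBrangesRovnyakSpace k S => continuous_deBrangesRovnyak_disc f
  -- With e = 1, the function B e is the backward shift of S.
  set e := kernelVector (kondratievKernel k) (kondratievOrigin k) with he
  have he1 : ∀ z, e z = 1 := fun z => by rw [he, kernelVector_apply, kondratievKernel_origin]
  have hR : ∀ x (ζ : 𝔻) z, ζ ≠ 0 → B x (ζ, z) = B e (ζ, z) * x z := fun x ζ z hζ => by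
    have hζ' : (ζ : ℂ) ≠ 0 := by simpa using hζ
    have h1 := hB x ζ z
    have h2 := hB e ζ z
    rw [he1] at h2
    apply mul_left_cancel₀ hζ'
    linear_combination h1 - x z * h2
  -- A is a corner of the contraction U^*, so the Neumann series inverts I - ζA for |ζ| < 1.
  have hAnorm : ‖A‖ ≤ 1 := by
    refine A.opNorm_le_bound zero_le_one fun f => ?_
    have hUn : ‖U‖ ≤ 1 := U.opNorm_le_bound zero_le_one fun u => by rw [hnorm, one_mul]
    have h1 : ‖ContinuousLinearMap.adjoint U (WithLp.toLp 2 (f, 0))‖ ≤ 1 * ‖f‖ := by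
      refine (ContinuousLinearMap.le_opNorm _ _).trans ?_
      rw [LinearIsometryEquiv.norm_map, WithLp.norm_toLp_fst]
      gcongr
    refine le_trans ?_ h1
    rw [happly]
    simpa using WithLp.norm_fst_le _ (p := 2) (WithLp.toLp 2 (A f + B 0, C f + D 0))
  refine ⟨A, B, C, D, fun f => isBackwardShift_of_mul_add (hA f) (hcont _),
    ⟨B e, isBackwardShift_of_mul_add (fun ζ z => ?_) (hcont _), fun x ζ z => ?_⟩, hC, hD, ?_,
    fun ζ => ?_⟩
  · simpa [he1] using hB e ζ z
  · by_cases hζ : ζ = 0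
    · subst hζ
      have hlim : Continuous fun ζ : 𝔻 => B e (ζ, z) * x z := (hcont (B e) z).mul continuous_const
      refine tendsto_nhds_unique (((hcont (B x) z).tendsto 0).mono_left nhdsWithin_le_nhds)
        (((hlim.tendsto 0).mono_left (nhdsWithin_le_nhds (s := {0}ᶜ))).congr' ?_)
      exact Filter.mem_of_superset self_mem_nhdsWithin fun ζ hζ => (hR x ζ z hζ).symm
    · exact hR x ζ z hζ
  · rw [hV, IsCoisometric, ContinuousLinearMap.adjoint_adjoint]
    exact (ContinuousLinearMap.norm_map_iff_adjoint_comp_self U).mp hnorm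
  · have hunit : IsUnit (1 - (ζ : ℂ) • A) := by
      refine isUnit_one_sub_of_norm_lt_one ?_
      rw [norm_smul]
      exact (mul_le_of_le_one_right (norm_nonneg _) hAnorm).trans_lt ζ.norm_lt_one
    refine ⟨hunit, fun x z => ?_⟩
    -- Evaluating (I - ζA)g = Bx at this same ζ, the backward shift formula collapses the left side
    -- to g(0, z) = (Cg)(z). So ζ Cg + Dx = ζ (Bx)(ζ, ·) + Dx = S(ζ, ·) x.
    set g := Ring.inverse (1 - (ζ : ℂ) • A) (B x) with hg
    have h1 : g - (ζ : ℂ) • A g = B x := by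
      have := congrArg (fun T : DeBrangesRovnyakSpace k S →L[ℂ] DeBrangesRovnyakSpace k S =>
        T (B x)) (Ring.mul_inverse_cancel _ hunit)
      simpa using this
    have h2 : g (ζ, z) - (ζ : ℂ) * A g (ζ, z) = B x (ζ, z) := by
      rw [← h1]
      simp
    have h3 := hA g ζ z
    have h4 := hB x ζ z
    have h5 : (D + (ζ : ℂ) • (C ∘L Ring.inverse (1 - (ζ : ℂ) • A) ∘L B)) x z
        = D x z + (ζ : ℂ) * C g z := by
      simp [hg]
    rw [h5, hC, hD]
    linear_combination -(ζ : ℂ) * h3 - (ζ : ℂ) * h2 - h4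

end
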